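/- **Setting.** Let $\mathbb S$ be a semiring ($1\neq 0$, multiplication not assumed commutative) that is * *Conway*: it is equipped with a map $a\mapsto a^*$ such that $(a+b)^*=a^*(ba^*)^*$ and $(ab)^*=1+a(ba)^*b$ for all $a,b$; * *positive*: $x+y=0$ implies $x=y=0$; * *refinement*: if $x+y=z+w$, there are $s,t,u,v$ with $s+t=x$, $s+u=z$, $u+v=y$, $t+v=w$. Let $T$ be a finite set (primitive tests) and let $\mathrm{Act}$ (actions) and $\mathrm{Out}$ (return values) be sets. Tests are $b,c::=\mathbb 0\mid\mathbb 1\mid t\in T\mid\bar b\mid b+c\mid bc$; $\equiv_{BA}$ is Boolean equivalence, $b\le c$ means $b+c\equiv_{BA}c$, and $\mathrm{At}$ is the finite set of atoms (minimal nonzero tests modulo $\equiv_{BA}$). The set $\mathrm{Exp}$ of wGKAT expressions is given by $$e,f::=p\in\mathrm{Act}\mid b\mid e+_bf\mid e;f\mid e^{(b)}\mid v\in\mathrm{Out}\mid e\oplus_{r,s}f\qquad(b\text{ a test},\ r,s\in\mathbb S),$$ and $\odot r:=\mathbb 1\oplus_{r,0}\mathbb 0$. **Automata and bisimilarity.** Let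 $\mathcal M_\omega(Y)$ be the set of finitely supported functions $Y\to\mathbb S$, with $\delta_y\in\mathcal M_\omega(Y)$ the function that is $1$ at $y$ and $0$ elsewhere, and $\nu[A]=\sum_{y\in A}\nu(y)$. An automaton is a set $X$ with $\beta:X\to\mathcal M_\omega(\{✓,✗\}+\mathrm{Out}+\mathrm{Act}\times X)^{\mathrm{At}}$. A map $h:X\to Y$ is a homomorphism $(X,\beta)\to(Y,\gamma)$ if $\gamma(h(x))_\alpha(o)=\beta(x)_\alpha(o)$ for $o\in\{✓,✗\}+\mathrm{Out}$ and $\gamma(h(x))_\alpha(p,y)=\beta(x)_\alpha[\{p\}\times h^{-1}(y)]$, for all $x$, $\alpha$, $p$, $y$. States $x\in X$ and $y\in Y$ of automata $(X,\beta)$, $(Y,\gamma)$ are bisimilar if there are $R\subseteq X\times Y$ with $(x,y)\in R$ and an automaton structure on $R$ for which both projections $R\to X$, $R\to Y$ are homomorphisms. The automaton $(\mathrm{Exp},\partial)$ is defined by * $\partial(p)_\alpha=\delta_{(p,\mathbb 1)}$, $\partial(v)_\alpha=\delta_v$; $\partial(b)_\alpha=\delta_{✓}$ if $\alpha\le b$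 and $\delta_{✗}$ if $\alpha\le\bar b$; * $\partial(e+_bf)_\alpha=\partial(e)_\alpha$ if $\alpha\le b$ and $\partial(f)_\alpha$ if $\alpha\le\bar b$; $\partial(e\oplus_{r,s}f)_\alpha=r\,\partial(e)_\alpha+s\,\partial(f)_\alpha$; * $\partial(e;f)_\alpha=\sum_d\partial(e)_\alpha(d)\,c(d)$, where $c(✓)=\partial(f)_\alpha$, $c(d)=\delta_d$ for $d\in\{✗\}\cup\mathrm{Out}$, and $c(p,e')=\delta_{(p,e';f)}$; * if $\alpha\le\bar b$, then $\partial(e^{(b)})_\alpha=\delta_{✓}$; if $\alpha\le b$, then, with $a=\partial(e)_\alpha(✓)$, $\partial(e^{(b)})_\alpha(d)=a^*\partial(e)_\alpha(d)$ for $d\in\{✗\}\cup\mathrm{Out}$, $\partial(e^{(b)})_\alpha(p,e';e^{(b)})=a^*\partial(e)_\alpha(p,e')$, and all other values are $0$. Write $e\sim f$ if $e$ and $f$ are bisimilar states of $(\mathrm{Exp},\partial)$. **Axioms.** Define $E(e)_\alpha\in\mathbb S$ by $E(p)_\alpha=E(v)_\alpha=0$; $E(b)_\alpha=1$ if $\alpha\le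 b$ and $0$ otherwise; $E(e\oplus_{r,s}f)_\alpha=rE(e)_\alpha+sE(f)_\alpha$; $E(e+_bf)_\alpha=E(e)_\alpha$ if $\alpha\le b$ and $E(f)_\alpha$ otherwise; $E(e;f)_\alpha=E(e)_\alpha E(f)_\alpha$; $E(e^{(b)})_\alpha=E(\bar b)_\alpha$. Let $\equiv$ be the least congruence on $\mathrm{Exp}$ (for all operations; tests, including those in $+_b$ and $(-)^{(b)}$, may be replaced by Boolean equivalent ones) such that for all expressions $e,f,g$, tests $b,c$, $v\in\mathrm{Out}$ and $r,s,t,u\in\mathbb S$: * (G1) $e+_be\equiv e$; (G2) $e+_bf\equiv b;e+_bf$; (G3) $e+_bf\equiv f+_{\bar b}e$; (G4) $(e+_bf)+_cg\equiv e+_{bc}(f+_cg)$; * (D1) $e\oplus_{r,s}(f+_bg)\equiv(e\oplus_{r,s}f)+_b(e\oplus_{r,s}g)$; (D2) $e\oplus_{r,s}(f\oplus_{t,u}g)\equiv e\oplus_{r,1}(f\oplus_{st,su}g)$; (D3) $b;(e\oplus_{r,s}f)\equiv b;(b;e\oplus_{r,s}b;f)$; * (S1) $\mathbb 1;e\equiv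 e\equiv e;\mathbb 1$; (S2) $(e;f);g\equiv e;(f;g)$; (S3) $\mathbb 0;e\equiv\mathbb 0$; (S4) $(e\oplus_{r,s}f);g\equiv e;g\oplus_{r,s}f;g$; (S5) $(e+_bf);g\equiv e;g+_bf;g$; (S6) $v;e\equiv v$; (S7) $b;c\equiv bc$; * (L1) $e^{(b)}\equiv e;e^{(b)}+_b\mathbb 1$; (L2) if $e\equiv(f\oplus_{r,s}\mathbb 1)+_cg$, then $c;e^{(b)}\equiv c;\big((\odot(s^*r);f;e^{(b)})+_b\mathbb 1\big)$; * (C1) $\odot1\equiv\mathbb 1$; (C2) $\odot0;e\equiv\odot0$; * (W1) $e\oplus_{r,s}e\equiv\odot(r+s);e$; (W2) $e\oplus_{r,s}f\equiv f\oplus_{s,r}e$; (W3) $e\oplus_{r,s}(f\oplus_{t,u}g)\equiv(e\oplus_{r,st}f)\oplus_{1,su}g$; (W4) $e\oplus_{ru,s}f\equiv(\odot u;e)\oplus_{r,s}f$; * (F1) if $g\equiv e;g+_bf$ and $E(e)_\alpha=0$ for all $\alpha\in\mathrm{At}$, then $g\equiv e^{(b)};f$. **Uniqueness Axiom.** A system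 of equations consists of a finite set $X$ and, for each $x\in X$ and $\alpha\in\mathrm{At}$, a finite formal weighted sum $\tau(x)_\alpha=\bigoplus_{i\in I}r_i\cdot t_i$, where $r_i\in\mathbb S$ and each $t_i$ is either an expression $f$ or a formal term $gx'$ with $g\in\mathrm{Exp}$, $x'\in X$. It is *Salomaa* if every $g$ in a term $gx'$ that occurs in it satisfies $E(g)_\alpha=0$ for all $\alpha\in\mathrm{At}$. For $h:X\to\mathrm{Exp}$, the expression $h^\#(\tau(x))$ is obtained by replacing each term $gx'$ by $g;h(x')$, each finite weighted sum by the expression given by $\bigoplus_{i\in\emptyset}r_i\cdot e_i=\odot0$ and $\bigoplus_{i\in I}r_i\cdot e_i=e_j\oplus_{r_j,1}\bigoplus_{i\in I\setminus\{j\}}r_i\cdot e_i$, and combining the resulting expressions $w_\alpha$ by nested guarded choices $w_{\alpha_1}+_{\alpha_1}(w_{\alpha_2}+_{\alpha_2}(\cdots(w_{\alpha_n}+_{\alpha_n}\mathbb 0)))$ over all atoms (up to $\equiv$ the orders chosen do not matter). For a congruence $\approx$, $h$ is a solution up to $\approx$ if $h(x)\approx h^\#(\tau(x))$ for all $x\in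 X$. Let $\mathrel{\dot\equiv}$ be the least congruence on $\mathrm{Exp}$ that contains $\equiv$ and satisfies (UA) if $f,g:X\to\mathrm{Exp}$ are solutions up to $\mathrel{\dot\equiv}$ of a Salomaa system on $X$, then $f(x)\mathrel{\dot\equiv}g(x)$ for all $x\in X$. **Theorem (Completeness).** For all $e,f\in\mathrm{Exp}$, if $e\sim f$, then $e\mathrel{\dot\equiv}f$. -/

import Mathlib

namespace WGKAT

/-! ### Weights -/

/-- A Conway semiring: a semiring with a star operation that satisfies the two Conway identities. -/
class ConwaySemiring (S : Type*) extends Semiring S, KStar S where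
  kstar_add (a b : S) : KStar.kstar (a + b) = KStar.kstar a * KStar.kstar (b * KStar.kstar a)
  kstar_mul (a b : S) : KStar.kstar (a * b) = 1 + a * KStar.kstar (b * a) * b

/-- Positivity (conicality) of a commutative monoid. -/
def IsPositive (M : Type*) [AddCommMonoid M] : Prop :=
  ∀ x y : M, x + y = 0 → x = 0 ∧ y = 0

/-- The refinement property of a commutative monoid. -/
def IsRefinement (M : Type*) [AddCommMonoid M] : Prop :=
  ∀ x y z w : M, x + y = z + w →
    ∃ s t u v : M, s + t = x ∧ s + u = z ∧ u + v = y ∧ t + v = w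

/-! ### Tests and atoms -/

/-- Boolean expressions over the primitive tests `T`. -/
inductive BExp (T : Type*) where
  | zero : BExp T
  | one : BExp T
  | prim (t : T) : BExp T
  | not (b : BExp T) : BExp T
  | or (b c : BExp T) : BExp T
  | and (b c : BExp T) : BExp T

/-- Truth value of a Boolean expression under a truth assignment. -/
def BExp.eval {T : Type*} (α : T → Bool) : BExp T → Bool
  | .zero => false
  | .one => true
  | .prim t => α t
  | .not b => !(b.eval α)
  | .or b c => b.eval α || c.eval α
  | .and b c => b.eval α && c.eval α

/-- Boolean equivalence. -/
def BAEquiv {T : Type*} (b c : BExp T) : Prop := ∀ α : T → Bool, b.eval α = c.eval α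

/-- Logical entailment, `b ≤ c ↔ b + c ≡ c`. -/
def BALe {T : Type*} (b c : BExp T) : Prop := BAEquiv (.or b c) c

/-- Atoms. For finite `T` the atoms of the free Boolean algebra on `T` are given by the truth
assignments; `atomExp` is the Boolean expression of an atom, and `minimal_iff_atomExp`,
`atomExp_injective` and `atomExp_le_iff` justify the identification. -/
abbrev At (T : Type*) := T → Bool

/-- The atom `α` as a test: the conjunction of the literals that are true under `α`. -/
noncomputable def atomExp {T : Type*} [Fintype T] (α : At T) : BExp T :=
  (Finset.univ : Finset T).toList.foldr
    (fun t b => .and (if α t then .prim t else .not (.prim t)) b) .one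

theorem eval_atomExp {T : Type*} [Fintype T] (α β : At T) :
    (atomExp α).eval β = true ↔ β = α := by
  have key : ∀ l : List T,
      (l.foldr (fun t b => BExp.and (if α t then .prim t else .not (.prim t)) b) .one).eval β
        = true ↔ ∀ t ∈ l, β t = α t := by
    intro l
    induction l with
    | nil => simp [BExp.eval]
    | cons t l ih =>
      simp only [List.foldr_cons, BExp.eval, Bool.and_eq_true, ih, List.forall_mem_cons]
      cases h : α t <;> simp [BExp.eval]
  rw [atomExp, key]
  simp [funext_iff]

/-- An atom entails `b` if and only if `b` is true under the corresponding assignment. -/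
theorem atomExp_le_iff {T : Type*} [Fintype T] (α : At T) (b : BExp T) :
    BALe (atomExp α) b ↔ b.eval α = true := by
  constructor
  · intro h
    have h1 := h α
    rw [BExp.eval, (eval_atomExp α α).2 rfl] at h1
    simpa using h1.symm
  · intro h β
    by_cases hβ : β = α
    · subst hβ; simp [BExp.eval, h]
    · have : (atomExp α).eval β = false := by
        simpa using (not_congr (eval_atomExp α β)).2 hβ
      simp [BExp.eval, this]

theorem atomExp_injective {T : Type*} [Fintype T] {α β : At T}
    (h : BAEquiv (atomExp α) (atomExp β)) : α = β := by
  rw [← eval_atomExp, ← h α, eval_atomExp]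

/-- Up to Boolean equivalence, the minimal nonzero tests are exactly the `atomExp α`. -/
theorem minimal_iff_atomExp {T : Type*} [Fintype T] (b : BExp T) :
    (¬ BAEquiv b .zero ∧ ∀ c, BALe c b → BAEquiv c .zero ∨ BAEquiv c b) ↔
      ∃ α : At T, BAEquiv b (atomExp α) := by
  constructor
  · rintro ⟨h0, hmin⟩
    obtain ⟨α, hα⟩ : ∃ α, b.eval α = true := by
      by_contra hne
      push Not at hne
      exact h0 fun α => by simpa [BExp.eval] using hne α
    refine ⟨α, ?_⟩
    rcases hmin (atomExp α) ((atomExp_le_iff α b).2 hα) with h | h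
    · have := h α
      rw [(eval_atomExp α α).2 rfl] at this
      simp [BExp.eval] at this
    · exact fun β => (h β).symm
  · rintro ⟨α, hα⟩
    refine ⟨fun h => ?_, fun c hc => ?_⟩
    · have := (hα α).symm.trans (h α)
      rw [(eval_atomExp α α).2 rfl] at this
      simp [BExp.eval] at this
    · have hle : ∀ β, c.eval β = true → β = α := fun β hβ => by
        have := hc β
        rw [BExp.eval, hβ, hα β] at this
        exact (eval_atomExp α β).1 (by simpa using this.symm)
      cases hcα : c.eval α
      · left
        intro β
        cases hβ : c.eval β
        · rfl
        · rw [hle β hβ, hcα] at hβ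
          cases hβ
      · right
        intro β
        rw [hα β, Bool.eq_iff_iff, eval_atomExp]
        exact ⟨hle β, fun h => h ▸ hcα⟩

/-! ### Expressions -/

/-- wGKAT expressions over primitive tests `T`, actions `Act`, return values `Out` and weights `S`.
`ite b e f` is `e +_b f`, `loop e b` is `e^(b)`, and `wchoice r s e f` is the weighted choice that
runs `e` with weight `r` and `f` with weight `s`. -/
inductive Exp (T Act Out S : Type*) where
  | act (p : Act) : Exp T Act Out S
  | test (b : BExp T) : Exp T Act Out S
  | ite (b : BExp T) (e f : Exp T Act Out S) : Exp T Act Out S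
  | seq (e f : Exp T Act Out S) : Exp T Act Out S
  | loop (e : Exp T Act Out S) (b : BExp T) : Exp T Act Out S
  | ret (v : Out) : Exp T Act Out S
  | wchoice (r s : S) (e f : Exp T Act Out S) : Exp T Act Out S

namespace Exp

/-- Scaling: the choice between true with weight `r` and false with weight `0`. -/
def scale {T Act Out S : Type*} [Zero S] (r : S) : Exp T Act Out S :=
  .wchoice r 0 (.test .one) (.test .zero)

/-- The weight of immediate acceptance. -/
def E {T Act Out S : Type*} [Semiring S] : Exp T Act Out S → At T → S
  | .act _, _ => 0
  | .ret _, _ => 0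
  | .test b, α => if b.eval α then 1 else 0
  | .wchoice r s e f, α => r * e.E α + s * f.E α
  | .ite b e f, α => if b.eval α then e.E α else f.E α
  | .seq e f, α => e.E α * f.E α
  | .loop _ b, α => if (BExp.not b).eval α then 1 else 0

end Exp

/-! ### Automata, homomorphisms, bisimilarity -/

/-- The set `2 + Out + Act × X`; `acc` and `rej` are immediate acceptance and rejection. -/
inductive Outcome (Act Out X : Type*) where
  | acc : Outcome Act Out X
  | rej : Outcome Act Out X
  | out (v : Out) : Outcome Act Out X
  | step (p : Act) (x : X) : Outcome Act Out X

/-- A transition function of a wGKAT automaton with states `X`; finitely supported weightings are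
finitely supported functions. -/
abbrev Automaton (T Act Out S X : Type*) [Zero S] := X → At T → (Outcome Act Out X →₀ S)

/-- The total weight of a set under a weighting. -/
noncomputable def total {Y S : Type*} [Semiring S] (φ : Y →₀ S) (A : Set Y) : S :=
  open Classical in ∑ y ∈ φ.support with y ∈ A, φ y

/-- The linearization of `h`. -/
noncomputable def lin {Y Z S : Type*} [Semiring S] (h : Y → (Z →₀ S)) (φ : Y →₀ S) : Z →₀ S :=
  φ.sum fun y r => r • h y

/-- wGKAT homomorphisms. -/
def IsHom {T Act Out S X Y : Type*} [Semiring S] (β : Automaton T Act Out S X)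
    (γ : Automaton T Act Out S Y) (f : X → Y) : Prop :=
  ∀ (x : X) (α : At T),
    γ (f x) α .acc = β x α .acc ∧
    γ (f x) α .rej = β x α .rej ∧
    (∀ v : Out, γ (f x) α (.out v) = β x α (.out v)) ∧
    (∀ (p : Act) (y : Y),
      γ (f x) α (.step p y) = total (β x α) {d | ∃ x' : X, f x' = y ∧ d = .step p x'})

/-- A relation is a bisimulation if it carries an automaton structure for which both projections
are homomorphisms. -/
def IsBisimulation {T Act Out S X Y : Type*} [Semiring S] (β : Automaton T Act Out S X)
    (γ : Automaton T Act Out S Y) (R : Set (X × Y)) : Prop :=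
  ∃ ρ : Automaton T Act Out S R, IsHom ρ β (fun z => z.1.1) ∧ IsHom ρ γ (fun z => z.1.2)

/-- Bisimilarity of states of two automata. -/
def Bisim {T Act Out S X Y : Type*} [Semiring S] (β : Automaton T Act Out S X)
    (γ : Automaton T Act Out S Y) (x : X) (y : Y) : Prop :=
  ∃ R : Set (X × Y), IsBisimulation β γ R ∧ (x, y) ∈ R

/-! ### Operational semantics -/

/-- Continue an outcome with the expression `f`: acceptance becomes the weighting `φ`, rejection
and return values stay, and a step to `e'` becomes a step to `e' ; f`. -/
noncomputable def continueWith {T Act Out S : Type*} [Semiring S]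
    (φ : Outcome Act Out (Exp T Act Out S) →₀ S) (f : Exp T Act Out S) :
    Outcome Act Out (Exp T Act Out S) → (Outcome Act Out (Exp T Act Out S) →₀ S)
  | .acc => φ
  | .rej => Finsupp.single .rej 1
  | .out v => Finsupp.single (.out v) 1
  | .step p e' => Finsupp.single (.step p (.seq e' f)) 1

/-- The operational semantics of expressions: the automaton whose states are expressions. -/
noncomputable def der {T Act Out S : Type*} [ConwaySemiring S] :
    Automaton T Act Out S (Exp T Act Out S)
  | .act p => fun _ => Finsupp.single (.step p (.test .one)) 1
  | .test b => fun α => if b.eval α then Finsupp.single .acc 1 else Finsupp.single .rej 1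
  | .ret v => fun _ => Finsupp.single (.out v) 1
  | .ite b e f => fun α => if b.eval α then der e α else der f α
  | .wchoice r s e f => fun α => r • der e α + s • der f α
  | .seq e f => fun α => lin (continueWith (der f α) f) (der e α)
  | .loop e b => fun α =>
      if b.eval α then
        KStar.kstar (der e α .acc) • lin (continueWith 0 (.loop e b)) (der e α)
      else Finsupp.single .acc 1

/-- Bisimilarity of expressions. -/
def Bisimilar {T Act Out S : Type*} [ConwaySemiring S] (e f : Exp T Act Out S) : Prop :=
  Bisim (der (T := T) (Act := Act) (Out := Out) (S := S)) der e f

/-! ### Axioms -/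

/-- The least congruence (for the two-sorted syntax, so that Boolean equivalent tests may be
exchanged) that satisfies the axioms of wGKAT. -/
inductive ProvEquiv {T Act Out S : Type*} [ConwaySemiring S] :
    Exp T Act Out S → Exp T Act Out S → Prop
  -- equivalence
  | refl (e) : ProvEquiv e e
  | symm {e f} : ProvEquiv e f → ProvEquiv f e
  | trans {e f g} : ProvEquiv e f → ProvEquiv f g → ProvEquiv e g
  -- congruence
  | congr_test {b c} : BAEquiv b c → ProvEquiv (.test b) (.test c)
  | congr_ite {b c e e' f f'} : BAEquiv b c → ProvEquiv e e' → ProvEquiv f f' →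
      ProvEquiv (.ite b e f) (.ite c e' f')
  | congr_seq {e e' f f'} : ProvEquiv e e' → ProvEquiv f f' → ProvEquiv (.seq e f) (.seq e' f')
  | congr_loop {b c e e'} : BAEquiv b c → ProvEquiv e e' → ProvEquiv (.loop e b) (.loop e' c)
  | congr_wchoice (r s) {e e' f f'} : ProvEquiv e e' → ProvEquiv f f' →
      ProvEquiv (.wchoice r s e f) (.wchoice r s e' f')
  -- guarded choice
  | G1 (b e) : ProvEquiv (.ite b e e) e
  | G2 (b e f) : ProvEquiv (.ite b e f) (.ite b (.seq (.test b) e) f)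
  | G3 (b e f) : ProvEquiv (.ite b e f) (.ite (.not b) f e)
  | G4 (b c e f g) : ProvEquiv (.ite c (.ite b e f) g) (.ite (.and b c) e (.ite c f g))
  -- distributivity
  | D1 (r s b e f g) :
      ProvEquiv (.wchoice r s e (.ite b f g)) (.ite b (.wchoice r s e f) (.wchoice r s e g))
  | D2 (r s t u e f g) :
      ProvEquiv (.wchoice r s e (.wchoice t u f g))
        (.wchoice r 1 e (.wchoice (s * t) (s * u) f g))
  | D3 (r s b e f) :
      ProvEquiv (.seq (.test b) (.wchoice r s e f))
        (.seq (.test b) (.wchoice r s (.seq (.test b) e) (.seq (.test b) f)))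
  -- sequencing
  | S1_left (e) : ProvEquiv (.seq (.test .one) e) e
  | S1_right (e) : ProvEquiv e (.seq e (.test .one))
  | S2 (e f g) : ProvEquiv (.seq (.seq e f) g) (.seq e (.seq f g))
  | S3 (e) : ProvEquiv (.seq (.test .zero) e) (.test .zero)
  | S4 (r s e f g) :
      ProvEquiv (.seq (.wchoice r s e f) g) (.wchoice r s (.seq e g) (.seq f g))
  | S5 (b e f g) : ProvEquiv (.seq (.ite b e f) g) (.ite b (.seq e g) (.seq f g))
  | S6 (v e) : ProvEquiv (.seq (.ret v) e) (.ret v)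
  | S7 (b c) : ProvEquiv (.seq (.test b) (.test c)) (.test (.and b c))
  -- loops
  | L1 (b e) : ProvEquiv (.loop e b) (.ite b (.seq e (.loop e b)) (.test .one))
  | L2 (r s b c e f g) : ProvEquiv e (.ite c (.wchoice r s f (.test .one)) g) →
      ProvEquiv (.seq (.test c) (.loop e b))
        (.seq (.test c)
          (.ite b (.seq (Exp.scale (KStar.kstar s * r)) (.seq f (.loop e b))) (.test .one)))
  -- scaling
  | C1 : ProvEquiv (Exp.scale 1) (.test .one)
  | C2 (e) : ProvEquiv (.seq (Exp.scale 0) e) (Exp.scale 0)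
  -- weighted choice
  | W1 (r s e) : ProvEquiv (.wchoice r s e e) (.seq (Exp.scale (r + s)) e)
  | W2 (r s e f) : ProvEquiv (.wchoice r s e f) (.wchoice s r f e)
  | W3 (r s t u e f g) :
      ProvEquiv (.wchoice r s e (.wchoice t u f g))
        (.wchoice 1 (s * u) (.wchoice r (s * t) e f) g)
  | W4 (r s u e f) : ProvEquiv (.wchoice (r * u) s e f) (.wchoice r s (.seq (Exp.scale u) e) f)
  -- fixpoint rule
  | F1 (b e f g) : ProvEquiv g (.ite b (.seq e g) f) → (∀ α, e.E α = 0) →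
      ProvEquiv g (.seq (.loop e b) f)

/-! ### Systems of equations and the Uniqueness Axiom -/

/-- Generalized guarded sum over the atoms in a list. -/
noncomputable def guardedSum {T Act Out S : Type*} [Fintype T] (w : At T → Exp T Act Out S) :
    List (At T) → Exp T Act Out S
  | [] => .test .zero
  | γ :: l => .ite (atomExp γ) (w γ) (guardedSum w l)

/-- Generalized weighted sum; the empty sum is the zero weighting, scaling by `0`. -/
def weightedSum {T Act Out S : Type*} [Semiring S] :
    List (S × Exp T Act Out S) → Exp T Act Out S
  | [] => Exp.scale 0
  | (r, e) :: l => .wchoice r 1 e (weightedSum l)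

/-- Terms `f` and `g x` with `f`, `g` expressions and `x` an indeterminate. -/
inductive TExp (T Act Out S X : Type*) where
  | const (f : Exp T Act Out S) : TExp T Act Out S X
  | var (g : Exp T Act Out S) (x : X) : TExp T Act Out S X

/-- Formal weighted sums of terms. -/
abbrev WExp (T Act Out S X : Type*) := List (S × TExp T Act Out S X)

/-- Formal guarded sums, over all atoms, of formal weighted sums of terms. -/
abbrev SExp (T Act Out S X : Type*) := At T → WExp T Act Out S X

/-- A Salomaa system: no `g` in a subterm `g x` can immediately accept. -/
def IsSalomaa {T Act Out S X : Type*} [Semiring S] (τ : X → SExp T Act Out S X) : Prop :=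
  ∀ (x : X) (α : At T) (r : S) (g : Exp T Act Out S) (y : X),
    (r, TExp.var g y) ∈ τ x α → ∀ α' : At T, g.E α' = 0

/-- Substitution of expressions for indeterminates in a term. -/
def TExp.subst {T Act Out S X : Type*} (h : X → Exp T Act Out S) :
    TExp T Act Out S X → Exp T Act Out S
  | .const f => f
  | .var g x => .seq g (h x)

/-- The expression `h^#(u)` obtained from `u` by substituting along `h`. The atoms are taken in some
fixed order. -/
noncomputable def hsharp {T Act Out S X : Type*} [Fintype T] [DecidableEq T] [Semiring S]
    (h : X → Exp T Act Out S) (u : SExp T Act Out S X) : Exp T Act Out S :=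
  guardedSum (fun α => weightedSum ((u α).map fun a => (a.1, a.2.subst h)))
    (Finset.univ : Finset (At T)).toList

/-- The least congruence that contains `ProvEquiv` and satisfies the Uniqueness Axiom: any two solutions
(up to this congruence) of a Salomaa system in finitely many indeterminates agree. -/
inductive DotEquiv {T Act Out S : Type*} [Fintype T] [DecidableEq T] [ConwaySemiring S] :
    Exp T Act Out S → Exp T Act Out S → Prop
  | of_equiv {e f} : ProvEquiv e f → DotEquiv e f
  | symm {e f} : DotEquiv e f → DotEquiv f e
  | trans {e f g} : DotEquiv e f → DotEquiv f g → DotEquiv e g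
  | congr_ite (b) {e e' f f'} : DotEquiv e e' → DotEquiv f f' →
      DotEquiv (.ite b e f) (.ite b e' f')
  | congr_seq {e e' f f'} : DotEquiv e e' → DotEquiv f f' → DotEquiv (.seq e f) (.seq e' f')
  | congr_loop (b) {e e'} : DotEquiv e e' → DotEquiv (.loop e b) (.loop e' b)
  | congr_wchoice (r s) {e e' f f'} : DotEquiv e e' → DotEquiv f f' →
      DotEquiv (.wchoice r s e f) (.wchoice r s e' f')
  | UA {X : Type} [Finite X] (τ : X → SExp T Act Out S X) (f g : X → Exp T Act Out S) :
      IsSalomaa τ →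
      (∀ x, DotEquiv (f x) (hsharp f (τ x))) →
      (∀ x, DotEquiv (g x) (hsharp g (τ x))) →
      ∀ x, DotEquiv (f x) (g x)

end WGKAT

/-! A bisimulation carries an automaton `ρ` whose two projections to the automaton of expressions
are homomorphisms. Read as equations, `ρ` is a Salomaa system: a state equals, under each atom, the
weighted sum of its outcomes, and every indeterminate is prefixed by an action. Both projections
solve this one system, so (UA) identifies related expressions.

A homomorphism is a solution by the fundamental theorem `mk_eq_linearCombination_der`: under an atom
`α`, each expression is provably the weighted sum of the outcomes in `der e α`. Its proof is linear
algebra. Modulo provable equality under a guard, expressions form an `S`-module in which weighted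
choices are linear combinations and sequencing on the right is linear. Equality under all atoms
gives back provable equality (`of_forall_atom`).

(UA) needs finitely many indeterminates. Each expression lies in a finite set closed under
transitions. By positivity no weights cancel, so transitions of `ρ` project to transitions of
expressions, and the pairs with both components in such finite sets are closed under `ρ`. -/

namespace WGKAT

/-! ### Equational reasoning under a guard -/

section Guards

variable {T Act Out S : Type*} [ConwaySemiring S]

local infix:50 " ≈ₚ " => ProvEquiv

instance : Trans (ProvEquiv (T := T) (Act := Act) (Out := Out) (S := S)) ProvEquiv ProvEquiv :=
  ⟨ProvEquiv.trans⟩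

namespace ProvEquiv

variable {e e' f f' : Exp T Act Out S} {b c : BExp T}

theorem seq_left (h : e ≈ₚ e') (f : Exp T Act Out S) : .seq e f ≈ₚ .seq e' f :=
  congr_seq h (refl f)

theorem seq_right (e : Exp T Act Out S) (h : f ≈ₚ f') : .seq e f ≈ₚ .seq e f' :=
  congr_seq (refl e) h

theorem ite_guard (h : BAEquiv b c) (e f : Exp T Act Out S) : .ite b e f ≈ₚ .ite c e f :=
  congr_ite h (refl e) (refl f)

theorem ite_left (b : BExp T) (h : e ≈ₚ e') (f : Exp T Act Out S) :
    .ite b e f ≈ₚ .ite b e' f :=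
  congr_ite (fun _ => rfl) h (refl f)

theorem ite_right (b : BExp T) (e : Exp T Act Out S) (h : f ≈ₚ f') :
    .ite b e f ≈ₚ .ite b e f' :=
  congr_ite (fun _ => rfl) (refl e) h

theorem ite_zero (e f : Exp T Act Out S) : .ite .zero e f ≈ₚ f :=
  calc Exp.ite .zero e f
    _ ≈ₚ .ite .zero (.seq (.test .zero) e) f := G2 _ _ _
    -- By (S3) everything after `zero` collapses to `zero`, so the dead branch may be replaced by
    -- `f`.
    _ ≈ₚ .ite .zero (.seq (.test .zero) f) f := ite_left _ ((S3 e).trans (S3 f).symm) _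
    _ ≈ₚ .ite .zero f f := (G2 _ _ _).symm
    _ ≈ₚ f := G1 _ _

theorem ite_ite_right (b : BExp T) (e f g : Exp T Act Out S) :
    .ite b e (.ite b f g) ≈ₚ .ite b e g :=
  calc Exp.ite b e (.ite b f g)
    _ ≈ₚ .ite (.not b) (.ite b f g) e := G3 _ _ _
    _ ≈ₚ .ite (.and b (.not b)) f (.ite (.not b) g e) := G4 _ _ _ _ _
    _ ≈ₚ .ite .zero f (.ite (.not b) g e) := ite_guard (fun α => by simp [BExp.eval]) _ _
    _ ≈ₚ .ite (.not b) g e := ite_zero _ _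
    _ ≈ₚ .ite b e g := (G3 _ _ _).symm

theorem ite_ite_left (b : BExp T) (e f g : Exp T Act Out S) :
    .ite b (.ite b e f) g ≈ₚ .ite b e g :=
  calc Exp.ite b (.ite b e f) g
    _ ≈ₚ .ite (.and b b) e (.ite b f g) := G4 _ _ _ _ _
    _ ≈ₚ .ite b e (.ite b f g) := ite_guard (fun α => by simp [BExp.eval]) _ _
    _ ≈ₚ .ite b e g := ite_ite_right _ _ _ _

theorem ite_guard_right (b : BExp T) (e f : Exp T Act Out S) :
    .ite b e f ≈ₚ .ite b e (.seq (.test (.not b)) f) :=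
  calc Exp.ite b e f
    _ ≈ₚ .ite (.not b) f e := G3 _ _ _
    _ ≈ₚ .ite (.not b) (.seq (.test (.not b)) f) e := G2 _ _ _
    _ ≈ₚ .ite b e (.seq (.test (.not b)) f) := (G3 _ _ _).symm

theorem test_seq_test_seq (b c : BExp T) (e : Exp T Act Out S) :
    .seq (.test b) (.seq (.test c) e) ≈ₚ .seq (.test (.and b c)) e :=
  (S2 _ _ _).symm.trans (seq_left (S7 _ _) _)

theorem test_eq_ite (b : BExp T) :
    (.test b : Exp T Act Out S) ≈ₚ .ite b (.test .one) (.test .zero) :=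
  calc (Exp.test b : Exp T Act Out S)
    _ ≈ₚ .ite b (.test b) (.test b) := (G1 _ _).symm
    _ ≈ₚ .ite b (.test b) (.seq (.test (.not b)) (.test b)) := ite_guard_right _ _ _
    _ ≈ₚ .ite b (.seq (.test b) (.test .one)) (.test .zero) :=
        congr_ite (fun _ => rfl) (S1_right _)
          ((S7 _ _).trans (congr_test fun α => by simp [BExp.eval]))
    _ ≈ₚ .ite b (.test .one) (.test .zero) := (G2 _ _ _).symm

theorem test_seq (b : BExp T) (e : Exp T Act Out S) :
    .seq (.test b) e ≈ₚ .ite b e (.test .zero) :=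
  calc Exp.seq (.test b) e
    _ ≈ₚ .seq (.ite b (.test .one) (.test .zero)) e := seq_left (test_eq_ite b) e
    _ ≈ₚ .ite b (.seq (.test .one) e) (.seq (.test .zero) e) := S5 _ _ _ _
    _ ≈ₚ .ite b e (.test .zero) := congr_ite (fun _ => rfl) (S1_left e) (S3 e)

theorem test_seq_ite (b : BExp T) (e f : Exp T Act Out S) :
    .seq (.test b) (.ite b e f) ≈ₚ .seq (.test b) e :=
  (test_seq b _).trans ((ite_ite_left b e f _).trans (test_seq b e).symm)

/-- Equivalence under the guard `c` implies equivalence under any test `b` below `c`. -/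
theorem guard_mono (hbc : ∀ α, b.eval α = true → c.eval α = true)
    (h : .seq (.test c) e ≈ₚ .seq (.test c) f) : .seq (.test b) e ≈ₚ .seq (.test b) f := by
  have key : ∀ g : Exp T Act Out S, .seq (.test b) (.seq (.test c) g) ≈ₚ .seq (.test b) g :=
    fun g => (test_seq_test_seq b c g).trans <| seq_left (congr_test fun α => by
      have := hbc α
      cases h1 : b.eval α <;> simp_all [BExp.eval]) g
  exact (key e).symm.trans ((seq_right _ h).trans (key f))

theorem guard_ite_of_le (hbc : ∀ α, c.eval α = true → b.eval α = true)
    (e f : Exp T Act Out S) : .seq (.test c) (.ite b e f) ≈ₚ .seq (.test c) e :=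
  guard_mono hbc (test_seq_ite b e f)

theorem guard_ite_of_disjoint (hbc : ∀ α, c.eval α = true → b.eval α = false)
    (e f : Exp T Act Out S) : .seq (.test c) (.ite b e f) ≈ₚ .seq (.test c) f :=
  (seq_right _ (G3 b e f)).trans <|
    guard_ite_of_le (b := .not b) (fun α h => by simp [BExp.eval, hbc α h]) f e

/-- Case distinction on `b`: (G1) duplicates an expression into both branches of a choice, and (G2)
with its mirror image guards each copy. -/
theorem of_guard_not (h : .seq (.test b) e ≈ₚ .seq (.test b) f)
    (h' : .seq (.test (.not b)) e ≈ₚ .seq (.test (.not b)) f) : e ≈ₚ f := by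
  have key : ∀ g : Exp T Act Out S,
      g ≈ₚ .ite b (.seq (.test b) g) (.seq (.test (.not b)) g) := fun g =>
    (G1 b g).symm.trans ((G2 _ _ _).trans (ite_guard_right _ _ _))
  exact (key e).trans ((congr_ite (fun _ => rfl) h h').trans (key f).symm)

theorem guard_or (h : .seq (.test b) e ≈ₚ .seq (.test b) f)
    (h' : .seq (.test c) e ≈ₚ .seq (.test c) f) :
    .seq (.test (.or b c)) e ≈ₚ .seq (.test (.or b c)) f := by
  refine of_guard_not (b := b) ?_ ?_
  · refine (test_seq_test_seq _ _ _).trans (.trans ?_ (test_seq_test_seq _ _ _).symm)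
    exact guard_mono (fun α => by simp +contextual [BExp.eval]) h
  · refine (test_seq_test_seq _ _ _).trans (.trans ?_ (test_seq_test_seq _ _ _).symm)
    exact guard_mono (fun α => by simp +contextual [BExp.eval]) h'

/-- Expressions that agree under every atom are provably equivalent. -/
theorem of_forall_atom [Fintype T]
    (h : ∀ α : At T, .seq (.test (atomExp α)) e ≈ₚ .seq (.test (atomExp α)) f) : e ≈ₚ f := by
  classical
  -- The equality is accumulated over finite disjunctions of atoms; the disjunction of all atoms is
  -- true everywhere, so it lies above `one`.
  have key : ∀ l : List (At T), ∃ b : BExp T, (∀ α ∈ l, b.eval α = true) ∧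
      .seq (.test b) e ≈ₚ .seq (.test b) f := by
    intro l
    induction l with
    | nil => exact ⟨.zero, by simp, (S3 e).trans (S3 f).symm⟩
    | cons α l ih =>
      obtain ⟨b, hb, hef⟩ := ih
      refine ⟨.or (atomExp α) b, ?_, guard_or (h α) hef⟩
      simp only [List.forall_mem_cons, BExp.eval, (eval_atomExp α α).2 rfl, Bool.true_or, true_and]
      intro β hβ
      simp [hb β hβ]
  obtain ⟨b, hb, hef⟩ := key (Finset.univ : Finset (At T)).toList
  exact (S1_left e).symm.trans ((guard_mono (fun α _ => hb α (by simp)) hef).trans (S1_left f))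

/-! ### Weighted choices -/

/-- Since `0 = 0 * 0`, (W4) puts a scaling by `0` in front of the branch of weight `0`, and (C2)
absorbs the rest. -/
theorem wchoice_zero_right_irrel (r : S) (e f : Exp T Act Out S) :
    .wchoice r 0 e f ≈ₚ .wchoice r 0 e (Exp.scale 0) := by
  have key : .wchoice 0 r f e ≈ₚ .wchoice 0 r (Exp.scale 0) e := by
    have := W4 0 r 0 f e
    rw [zero_mul] at this
    exact this.trans (congr_wchoice _ _ (C2 f) (refl e))
  exact (W2 _ _ _ _).trans (key.trans (W2 _ _ _ _))

/-- The irrelevant branch is exchanged for `0 ; e`, after which (S4) factors `e` out and leaves the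
definition of `Exp.scale r`. -/
theorem wchoice_zero_right (r : S) (e f : Exp T Act Out S) :
    .wchoice r 0 e f ≈ₚ .seq (Exp.scale r) e := by
  refine (wchoice_zero_right_irrel r e f).trans ?_
  refine (wchoice_zero_right_irrel r e (.test .zero)).symm.trans ?_
  exact (congr_wchoice _ _ (S1_left e).symm (S3 e).symm).trans (S4 _ _ _ _ _).symm

theorem wchoice_zero_left (s : S) (e f : Exp T Act Out S) :
    .wchoice 0 s e f ≈ₚ .seq (Exp.scale s) f :=
  (W2 _ _ _ _).trans (wchoice_zero_right s f e)

theorem scale_one_seq (e : Exp T Act Out S) : .seq (Exp.scale 1) e ≈ₚ e :=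
  (seq_left C1 e).trans (S1_left e)

theorem wchoice_eq_add (r s : S) (e f : Exp T Act Out S) :
    .wchoice r s e f ≈ₚ .wchoice 1 1 (.seq (Exp.scale r) e) (.seq (Exp.scale s) f) := by
  have h1 := W4 1 s r e f
  have h2 := W4 1 1 s f (.seq (Exp.scale r) e)
  rw [one_mul] at h1 h2
  exact h1.trans ((W2 _ _ _ _).trans (h2.trans (W2 _ _ _ _)))

theorem scale_seq_scale_seq (r s : S) (e : Exp T Act Out S) :
    .seq (Exp.scale r) (.seq (Exp.scale s) e) ≈ₚ .seq (Exp.scale (r * s)) e :=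
  calc Exp.seq (Exp.scale r) (.seq (Exp.scale s) e)
    _ ≈ₚ .wchoice r 0 (.seq (Exp.scale s) e) e := (wchoice_zero_right _ _ _).symm
    _ ≈ₚ .wchoice (r * s) 0 e e := (W4 _ _ _ _ _).symm
    _ ≈ₚ .seq (Exp.scale (r * s)) e := wchoice_zero_right _ _ _

/-- Scaling is a choice whose other branch has weight `0`, so (D2) pushes the scalar into the inner
weights. -/
theorem scale_seq_wchoice (r s t : S) (e f : Exp T Act Out S) :
    .seq (Exp.scale r) (.wchoice s t e f) ≈ₚ .wchoice (r * s) (r * t) e f :=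
  calc Exp.seq (Exp.scale r) (.wchoice s t e f)
    _ ≈ₚ .wchoice 0 r e (.wchoice s t e f) := (wchoice_zero_left _ _ _).symm
    _ ≈ₚ .wchoice 0 1 e (.wchoice (r * s) (r * t) e f) := D2 _ _ _ _ _ _ _
    _ ≈ₚ .seq (Exp.scale 1) (.wchoice (r * s) (r * t) e f) := wchoice_zero_left _ _ _
    _ ≈ₚ .wchoice (r * s) (r * t) e f := scale_one_seq _

theorem scale_zero_add (e : Exp T Act Out S) : .wchoice 1 1 (Exp.scale 0) e ≈ₚ e :=
  calc Exp.wchoice 1 1 (Exp.scale 0) e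
    _ ≈ₚ .wchoice 1 1 (.seq (Exp.scale 0) e) e := congr_wchoice _ _ (C2 e).symm (refl e)
    _ ≈ₚ .wchoice (1 * 0) 1 e e := (W4 _ _ _ _ _).symm
    _ ≈ₚ e := by
      rw [mul_zero]
      exact (wchoice_zero_left _ _ _).trans (scale_one_seq e)

theorem add_assoc (e f g : Exp T Act Out S) :
    .wchoice 1 1 (.wchoice 1 1 e f) g ≈ₚ .wchoice 1 1 e (.wchoice 1 1 f g) := by
  have := W3 1 1 1 1 e f g
  rw [one_mul] at this
  exact this.symm

theorem guard_wchoice (r s : S) (h : .seq (.test c) e ≈ₚ .seq (.test c) e')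
    (h' : .seq (.test c) f ≈ₚ .seq (.test c) f') :
    .seq (.test c) (.wchoice r s e f) ≈ₚ .seq (.test c) (.wchoice r s e' f') :=
  (D3 _ _ _ _ _).trans ((seq_right _ (congr_wchoice _ _ h h')).trans (D3 _ _ _ _ _).symm)

theorem guard_seq (h : .seq (.test c) e ≈ₚ .seq (.test c) e') (f : Exp T Act Out S) :
    .seq (.test c) (.seq e f) ≈ₚ .seq (.test c) (.seq e' f) :=
  (S2 _ _ _).symm.trans ((seq_left h f).trans (S2 _ _ _))

theorem guard_scale_seq (r : S) (h : .seq (.test c) e ≈ₚ .seq (.test c) e') :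
    .seq (.test c) (.seq (Exp.scale r) e) ≈ₚ .seq (.test c) (.seq (Exp.scale r) e') :=
  (seq_right _ (wchoice_zero_right r e (.test .zero)).symm).trans <|
    (guard_wchoice r 0 h (refl _)).trans (seq_right _ (wchoice_zero_right r e' _))

end ProvEquiv

end Guards

/-! ### The module of expressions under a guard -/

section Module

variable {T Act Out S : Type*} [ConwaySemiring S]

/-- Provable equivalence under the guard `c`. -/
def guardSetoid (Act Out S : Type*) [ConwaySemiring S] (c : BExp T) :
    Setoid (Exp T Act Out S) where
  r e f := ProvEquiv (.seq (.test c) e) (.seq (.test c) f)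
  iseqv := ⟨fun _ => .refl _, .symm, .trans⟩

/-- Expressions modulo provable equivalence under the guard `c`. -/
def GuardedExp (Act Out S : Type*) [ConwaySemiring S] (c : BExp T) : Type _ :=
  Quotient (guardSetoid Act Out S c)

namespace GuardedExp

variable {c : BExp T}

/-- The class of an expression. -/
def mk (c : BExp T) (e : Exp T Act Out S) : GuardedExp Act Out S c :=
  Quotient.mk (guardSetoid Act Out S c) e

theorem mk_eq_mk {e f : Exp T Act Out S} :
    mk c e = mk c f ↔ ProvEquiv (.seq (.test c) e) (.seq (.test c) f) :=
  Quotient.eq (r := guardSetoid Act Out S c)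

theorem mk_congr {e f : Exp T Act Out S} (h : ProvEquiv e f) : mk c e = mk c f :=
  mk_eq_mk.2 (.seq_right _ h)

theorem ind {P : GuardedExp Act Out S c → Prop} (h : ∀ e, P (mk c e)) (x) : P x :=
  Quotient.ind h x

/-- The zero vector is the empty weighting, not the test `zero`: rejection is an outcome that
carries weight. -/
instance : Zero (GuardedExp Act Out S c) := ⟨mk c (Exp.scale 0)⟩

instance : Add (GuardedExp Act Out S c) :=
  ⟨Quotient.map₂ (.wchoice 1 1) fun _ _ h _ _ h' => ProvEquiv.guard_wchoice 1 1 h h'⟩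

instance : SMul S (GuardedExp Act Out S c) :=
  ⟨fun r => Quotient.map (.seq (Exp.scale r)) fun _ _ h => ProvEquiv.guard_scale_seq r h⟩

theorem mk_add (e f : Exp T Act Out S) : mk c e + mk c f = mk c (.wchoice 1 1 e f) := rfl

theorem smul_mk (r : S) (e : Exp T Act Out S) : r • mk c e = mk c (.seq (Exp.scale r) e) := rfl

theorem mk_wchoice (r s : S) (e f : Exp T Act Out S) :
    mk c (.wchoice r s e f) = r • mk c e + s • mk c f :=
  mk_congr (.wchoice_eq_add r s e f)

instance : AddCommMonoid (GuardedExp Act Out S c) where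
  add_assoc x y z := by
    induction x using ind; induction y using ind; induction z using ind
    exact mk_congr (.add_assoc _ _ _)
  zero_add x := by
    induction x using ind
    exact mk_congr (.scale_zero_add _)
  add_zero x := by
    induction x using ind
    exact mk_congr ((ProvEquiv.W2 _ _ _ _).trans (.scale_zero_add _))
  add_comm x y := by
    induction x using ind; induction y using ind
    exact mk_congr (.W2 _ _ _ _)
  nsmul := nsmulRec

instance : Module S (GuardedExp Act Out S c) where
  one_smul x := by
    induction x using ind
    exact mk_congr (.scale_one_seq _)
  mul_smul r s x := by
    induction x using ind
    exact mk_congr (ProvEquiv.scale_seq_scale_seq _ _ _).symm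
  smul_zero r := by
    have h := ProvEquiv.scale_seq_scale_seq r 0 (.test .one : Exp T Act Out S)
    rw [mul_zero] at h
    exact mk_congr ((ProvEquiv.seq_right _ (.S1_right _)).trans
      (h.trans (ProvEquiv.S1_right _).symm))
  smul_add r x y := by
    induction x using ind; induction y using ind
    rw [mk_add, smul_mk, smul_mk, smul_mk, mk_add]
    have h := ProvEquiv.scale_seq_wchoice (T := T) (Act := Act) (Out := Out) r 1 1
    simp only [mul_one] at h
    exact mk_congr ((h _ _).trans (.wchoice_eq_add _ _ _ _))
  add_smul r s x := by
    induction x using ind with | _ e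
    rw [← mk_wchoice, smul_mk]
    exact mk_congr (ProvEquiv.W1 _ _ _).symm
  zero_smul x := by
    induction x using ind
    exact mk_congr (.C2 _)

/-- Sequencing with `f` on the right is linear. -/
def seqRight (c : BExp T) (f : Exp T Act Out S) :
    GuardedExp Act Out S c →ₗ[S] GuardedExp Act Out S c where
  toFun := Quotient.map (fun e => .seq e f) fun _ _ h => ProvEquiv.guard_seq h f
  map_add' x y := by
    induction x using ind; induction y using ind
    exact mk_congr (.S4 _ _ _ _ _)
  map_smul' r x := by
    induction x using ind
    exact mk_congr (.S2 _ _ _)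

@[simp]
theorem seqRight_mk (e f : Exp T Act Out S) : seqRight c f (mk c e) = mk c (.seq e f) := rfl

theorem mk_weightedSum (l : List (S × Exp T Act Out S)) :
    mk c (weightedSum l) = (l.map fun a => a.1 • mk c a.2).sum := by
  induction l with
  | nil => rfl
  | cons a l ih =>
    obtain ⟨r, e⟩ := a
    rw [weightedSum, mk_wchoice, ih, one_smul, List.map_cons, List.sum_cons]

section Atom

variable [Fintype T] (α : At T)

/-- An atom decides every test, so one branch of the choice is dead under it. -/
theorem mk_ite (b : BExp T) (e f : Exp T Act Out S) :
    mk (atomExp α) (.ite b e f) =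
      if b.eval α then mk (atomExp α) e else mk (atomExp α) f := by
  cases h : b.eval α
  · exact mk_eq_mk.2 (.guard_ite_of_disjoint (fun β hβ => (eval_atomExp α β).1 hβ ▸ h) e f)
  · exact mk_eq_mk.2 (.guard_ite_of_le (fun β hβ => (eval_atomExp α β).1 hβ ▸ h) e f)

theorem mk_test (b : BExp T) :
    (mk (atomExp α) (.test b) : GuardedExp Act Out S _) =
      if b.eval α then mk (atomExp α) (.test .one) else mk (atomExp α) (.test .zero) := by
  rw [← mk_ite]
  exact mk_congr (.test_eq_ite b)

theorem mk_guardedSum (w : At T → Exp T Act Out S) {l : List (At T)} (h : α ∈ l) :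
    mk (atomExp α) (guardedSum w l) = mk (atomExp α) (w α) := by
  induction l with
  | nil => cases h
  | cons γ l ih =>
    rw [guardedSum, mk_ite]
    by_cases hγ : α = γ
    · rw [if_pos ((eval_atomExp γ α).2 hγ), hγ]
    · rw [if_neg fun h' => hγ ((eval_atomExp γ α).1 h')]
      exact ih ((List.mem_cons.1 h).resolve_left hγ)

theorem mk_hsharp [DecidableEq T] {X : Type*} (h : X → Exp T Act Out S)
    (u : SExp T Act Out S X) :
    mk (atomExp α) (hsharp h u) =
      ((u α).map fun a => a.1 • mk (atomExp α) (a.2.subst h)).sum := by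
  rw [hsharp, mk_guardedSum α _ (by simp), mk_weightedSum, List.map_map]
  rfl

end Atom

end GuardedExp

end Module

/-! ### The fundamental theorem -/

section Fundamental

variable {T Act Out S : Type*} [ConwaySemiring S]

/-- The expression that performs a given outcome. -/
def Outcome.toExp : Outcome Act Out (Exp T Act Out S) → Exp T Act Out S
  | .acc => .test .one
  | .rej => .test .zero
  | .out v => .ret v
  | .step p e => .seq (.act p) e

theorem map_lin {Y Z M : Type*} [AddCommMonoid M] [Module S M] (L : (Z →₀ S) →ₗ[S] M)
    (h : Y → (Z →₀ S)) (φ : Y →₀ S) : L (lin h φ) = φ.sum fun y r => r • L (h y) := by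
  simp [lin, Finsupp.sum, map_sum]

/-- Every element is the class of an expression. -/
theorem GuardedExp.exists_mk_eq {c : BExp T} (x : GuardedExp Act Out S c) :
    ∃ e, GuardedExp.mk c e = x :=
  Quotient.exists_rep x

open GuardedExp in
/-- Under the atom `α`, an expression is the weighted sum of its outcomes. -/
theorem mk_eq_linearCombination_der [Fintype T] (α : At T) (e : Exp T Act Out S) :
    mk (atomExp α) e =
      Finsupp.linearCombination S (fun d => mk (atomExp α) d.toExp) (der e α) := by
  induction e with
  | act p =>
    simp only [der, Finsupp.linearCombination_single, one_smul]
    exact mk_congr (.S1_right _)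
  | test b =>
    rw [mk_test]
    simp only [der]
    split_ifs <;> simp [Outcome.toExp]
  | ret v => simp [der, Outcome.toExp]
  | ite b e f ihe ihf =>
    rw [mk_ite]
    simp only [der]
    split_ifs <;> assumption
  | wchoice r s e f ihe ihf =>
    rw [mk_wchoice, ihe, ihf]
    simp [der]
  | seq e f ihe ihf =>
    rw [← seqRight_mk, ihe, Finsupp.linearCombination_apply, map_finsuppSum]
    simp only [der, map_lin, map_smul, seqRight_mk]
    refine Finsupp.sum_congr fun d _ => congrArg _ ?_
    cases d with
    | acc => exact (mk_congr (.S1_left f)).trans ihf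
    | rej => simpa [continueWith, Outcome.toExp] using mk_congr (.S3 f)
    | out v => simpa [continueWith, Outcome.toExp] using mk_congr (.S6 v f)
    | step p e' => simpa [continueWith, Outcome.toExp] using mk_congr (.S2 _ _ _)
  | loop e b ih =>
    cases hb : b.eval α
    · rw [mk_congr (.L1 b e), mk_ite]
      simp [der, hb, Outcome.toExp]
    -- `k` represents the non-accepting part of `e`. Under `α`, `e` is then the sum of `k` and
    -- immediate acceptance with weight `der e α .acc`, the shape that (L2) requires.
    · obtain ⟨k, hk⟩ := GuardedExp.exists_mk_eq
        (Finsupp.linearCombination S (fun d => mk (atomExp α) d.toExp) ((der e α).erase .acc))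
      have he : ProvEquiv e
          (.ite (atomExp α) (.wchoice 1 (der e α .acc) k (.test .one)) e) := by
        have : mk (atomExp α) e =
            mk (atomExp α) (.wchoice 1 (der e α .acc) k (.test .one)) := by
          rw [mk_wchoice, hk, one_smul, ih]
          conv_lhs => rw [← Finsupp.erase_add_single .acc (der e α)]
          simp [Outcome.toExp]
        -- An equality under the guard `α` becomes an unguarded one by keeping `e` itself as the
        -- other branch.
        exact (ProvEquiv.G1 _ _).symm.trans <| (ProvEquiv.G2 _ _ _).trans <|
          (ProvEquiv.ite_left _ (mk_eq_mk.1 this) _).trans (ProvEquiv.G2 _ _ _).symm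
      rw [mk_eq_mk.2 (.L2 1 (der e α .acc) b (atomExp α) e k e he), mk_ite, if_pos hb, ← smul_mk,
        ← seqRight_mk, hk, mul_one]
      simp only [der, hb, if_true, map_smul, map_lin]
      rw [Finsupp.linearCombination_apply, map_finsuppSum]
      simp only [map_smul, seqRight_mk]
      congr 1
      -- Acceptance continues with the weighting `0`, so its summand vanishes and only the part
      -- represented by `k` remains.
      rw [← Finsupp.add_sum_erase' (der e α) .acc _ (by simp)]
      simp only [continueWith, map_zero, smul_zero, zero_add]
      refine Finsupp.sum_congr fun d hd => congrArg _ ?_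
      cases d with
      | acc => simp at hd
      | rej => simpa [continueWith, Outcome.toExp] using mk_congr (.S3 _)
      | out v => simpa [continueWith, Outcome.toExp] using mk_congr (.S6 v _)
      | step p e' => simpa [continueWith, Outcome.toExp] using mk_congr (.S2 _ _ _)

end Fundamental

/-! ### Finitely many derivatives -/

section Reachable

variable {T Act Out S : Type*} [ConwaySemiring S]

theorem exists_of_lin_apply_ne_zero {Y Z : Type*} {h : Y → (Z →₀ S)} {φ : Y →₀ S} {z : Z}
    (hz : lin h φ z ≠ 0) : ∃ y, φ y ≠ 0 ∧ h y z ≠ 0 := by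
  rw [lin, Finsupp.sum_apply] at hz
  obtain ⟨y, -, hy⟩ := Finset.exists_ne_zero_of_sum_ne_zero hz
  exact ⟨y, left_ne_zero_of_mul hy, right_ne_zero_of_mul hy⟩

/-- A set of states that is closed under transitions. -/
def IsClosedUnder {X : Type*} (β : Automaton T Act Out S X) (F : Set X) : Prop :=
  ∀ x ∈ F, ∀ α p y, β x α (.step p y) ≠ 0 → y ∈ F

theorem exists_of_continueWith_ne_zero {φ : Outcome Act Out (Exp T Act Out S) →₀ S}
    {f y : Exp T Act Out S} {p : Act} {d : Outcome Act Out (Exp T Act Out S)}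
    (h : continueWith φ f d (.step p y) ≠ 0) :
    φ (.step p y) ≠ 0 ∨ ∃ e', d = .step p e' ∧ y = .seq e' f := by
  classical
  cases d with
  | acc => exact .inl h
  | rej => simp [continueWith] at h
  | out v => simp [continueWith] at h
  | step q e' =>
    rw [continueWith, Finsupp.single_apply] at h
    split_ifs at h with heq
    · cases heq
      exact .inr ⟨e', rfl, rfl⟩
    · exact absurd rfl h

theorem exists_of_der_seq_ne_zero {e f y : Exp T Act Out S} {α : At T} {p : Act}
    (h : der (.seq e f) α (.step p y) ≠ 0) :
    der f α (.step p y) ≠ 0 ∨ ∃ e', der e α (.step p e') ≠ 0 ∧ y = .seq e' f := by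
  simp only [der] at h
  obtain ⟨d, hd, hd'⟩ := exists_of_lin_apply_ne_zero h
  rcases exists_of_continueWith_ne_zero hd' with h | ⟨e', rfl, rfl⟩
  · exact .inl h
  · exact .inr ⟨e', hd, rfl⟩

theorem exists_of_der_loop_ne_zero {e y : Exp T Act Out S} {b : BExp T} {α : At T} {p : Act}
    (h : der (.loop e b) α (.step p y) ≠ 0) :
    ∃ e', der e α (.step p e') ≠ 0 ∧ y = .seq e' (.loop e b) := by
  simp only [der] at h
  split_ifs at h
  · rw [Finsupp.smul_apply] at h
    obtain ⟨d, hd, hd'⟩ := exists_of_lin_apply_ne_zero (right_ne_zero_of_mul h)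
    rcases exists_of_continueWith_ne_zero hd' with h | ⟨e', rfl, rfl⟩
    · exact absurd rfl h
    · exact ⟨e', hd, rfl⟩
  · simp at h

/-- As with Antimirov's partial derivatives, successors of `e ; f` are successors of `f` or have the
form `e' ; f`, and successors of a loop have the form `e' ; e^(b)`. Finite closed sets for the parts
thus yield one for the whole. -/
theorem exists_finite_isClosedUnder_der (e : Exp T Act Out S) :
    ∃ F : Set (Exp T Act Out S), F.Finite ∧ e ∈ F ∧ IsClosedUnder der F := by
  classical
  have test_step : ∀ (b : BExp T) (α : At T) (p : Act) (y : Exp T Act Out S),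
      der (.test b) α (.step p y) = 0 := fun b α p y => by
    simp only [der]; split_ifs <;> simp
  induction e with
  | act p =>
    refine ⟨{.act p, .test .one}, by simp, by simp, ?_⟩
    rintro x (rfl | rfl) α q y h
    · simp only [der, Finsupp.single_apply] at h
      split_ifs at h with heq
      · cases heq; simp
      · exact absurd rfl h
    · exact absurd (test_step _ _ _ _) h
  | test b =>
    refine ⟨{.test b}, by simp, by simp, ?_⟩
    rintro x rfl α q y h
    exact absurd (test_step _ _ _ _) h
  | ret v =>
    refine ⟨{.ret v}, by simp, by simp, ?_⟩
    rintro x rfl α q y h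
    simp [der] at h
  | ite b e f ihe ihf =>
    obtain ⟨F, hF, he, hFc⟩ := ihe
    obtain ⟨G, hG, hf, hGc⟩ := ihf
    refine ⟨insert (.ite b e f) (F ∪ G), (hF.union hG).insert _, by simp, ?_⟩
    rintro x (rfl | hx | hx) α p y h
    · simp only [der] at h
      split_ifs at h
      · exact .inr (.inl (hFc e he α p y h))
      · exact .inr (.inr (hGc f hf α p y h))
    · exact .inr (.inl (hFc x hx α p y h))
    · exact .inr (.inr (hGc x hx α p y h))
  | wchoice r s e f ihe ihf =>
    obtain ⟨F, hF, he, hFc⟩ := ihe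
    obtain ⟨G, hG, hf, hGc⟩ := ihf
    refine ⟨insert (.wchoice r s e f) (F ∪ G), (hF.union hG).insert _, by simp, ?_⟩
    rintro x (rfl | hx | hx) α p y h
    · by_cases h1 : der e α (.step p y) = 0
      · by_cases h2 : der f α (.step p y) = 0
        · simp [der, h1, h2] at h
        · exact .inr (.inr (hGc f hf α p y h2))
      · exact .inr (.inl (hFc e he α p y h1))
    · exact .inr (.inl (hFc x hx α p y h))
    · exact .inr (.inr (hGc x hx α p y h))
  | seq e f ihe ihf =>
    obtain ⟨F, hF, he, hFc⟩ := ihe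
    obtain ⟨G, hG, hf, hGc⟩ := ihf
    refine ⟨(fun x => .seq x f) '' F ∪ G, (hF.image _).union hG, .inl ⟨e, he, rfl⟩, ?_⟩
    rintro x (⟨x, hx, rfl⟩ | hx) α p y h
    · rcases exists_of_der_seq_ne_zero h with h | ⟨e', he', rfl⟩
      · exact .inr (hGc f hf α p y h)
      · exact .inl ⟨e', hFc x hx α p e' he', rfl⟩
    · exact .inr (hGc x hx α p y h)
  | loop e b ih =>
    obtain ⟨F, hF, he, hFc⟩ := ih
    refine ⟨insert (.loop e b) ((fun x => .seq x (.loop e b)) '' F),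
      (hF.image _).insert _, by simp, ?_⟩
    have hloop : ∀ α p y, der (.loop e b) α (.step p y) ≠ 0 →
        y ∈ (fun x => Exp.seq x (.loop e b)) '' F := fun α p y h => by
      obtain ⟨e', he', rfl⟩ := exists_of_der_loop_ne_zero h
      exact ⟨e', hFc e he α p e' he', rfl⟩
    rintro x (rfl | ⟨x, hx, rfl⟩) α p y h
    · exact .inr (hloop α p y h)
    · rcases exists_of_der_seq_ne_zero h with h | ⟨e', he', rfl⟩
      · exact .inr (hloop α p y h)
      · exact .inr ⟨e', hFc x hx α p e' he', rfl⟩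

end Reachable

/-! ### Homomorphisms -/

section Hom

variable {T Act Out S X Y : Type*}

/-- The action of a map of states on outcomes. -/
def Outcome.map (f : X → Y) : Outcome Act Out X → Outcome Act Out Y
  | .acc => .acc
  | .rej => .rej
  | .out v => .out v
  | .step p x => .step p (f x)

theorem mapDomain_apply_eq_total [Semiring S] (f : X → Y) (φ : X →₀ S) (y : Y) :
    φ.mapDomain f y = total φ {x | f x = y} := by
  classical
  simp only [Finsupp.mapDomain, Finsupp.sum, Finsupp.finsetSum_apply, total, Finset.sum_filter,
    Finsupp.single_apply, Set.mem_ofPred_eq]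

theorem total_singleton [Semiring S] (φ : X →₀ S) (x : X) : total φ {x} = φ x := by
  classical
  simp only [total, Set.mem_singleton_iff, Finset.sum_filter, Finset.sum_ite_eq',
    Finsupp.mem_support_iff]
  split_ifs with h
  · rfl
  · exact (not_not.1 h).symm

/-- The four clauses of `IsHom` amount to a coalgebra morphism: only steps can be merged, since
every other outcome has itself as its sole preimage under `Outcome.map f`. -/
theorem IsHom.eq_mapDomain [Semiring S] {β : Automaton T Act Out S X}
    {γ : Automaton T Act Out S Y} {f : X → Y} (hf : IsHom β γ f) (x : X) (α : At T) :
    γ (f x) α = (β x α).mapDomain (Outcome.map f) := by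
  obtain ⟨hacc, hrej, hout, hstep⟩ := hf x α
  ext d
  rw [mapDomain_apply_eq_total]
  cases d with
  | acc =>
    rw [hacc, ← total_singleton]
    congr 1; ext d; cases d <;> simp [Outcome.map]
  | rej =>
    rw [hrej, ← total_singleton]
    congr 1; ext d; cases d <;> simp [Outcome.map]
  | out v =>
    rw [hout, ← total_singleton]
    congr 1; ext d; cases d <;> simp [Outcome.map]
  | step p y =>
    rw [hstep]
    congr 1; ext d
    cases d with
    | step q x' =>
      simp only [Outcome.map, Set.mem_ofPred_eq, Outcome.step.injEq]
      exact ⟨fun ⟨_, h1, h2, h3⟩ => ⟨h2, h3 ▸ h1⟩, fun ⟨h1, h2⟩ => ⟨x', h2, h1, rfl⟩⟩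
    | _ => simp [Outcome.map]

theorem IsPositive.eq_zero_of_sum {M : Type*} [AddCommMonoid M] (hM : IsPositive M)
    {ι : Type*} {s : Finset ι} {w : ι → M} (h : ∑ i ∈ s, w i = 0) {i : ι} (hi : i ∈ s) :
    w i = 0 := by
  classical
  rw [← Finset.add_sum_erase s w hi] at h
  exact (hM _ _ h).1

/-- Over positive weights, homomorphisms preserve transitions. -/
theorem IsHom.step_ne_zero [Semiring S] (hS : IsPositive S) {β : Automaton T Act Out S X}
    {γ : Automaton T Act Out S Y} {f : X → Y} (hf : IsHom β γ f) {x x' : X} {α : At T} {p : Act}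
    (h : β x α (.step p x') ≠ 0) : γ (f x) α (.step p (f x')) ≠ 0 := by
  classical
  rw [(hf x α).2.2.2]
  intro h0
  -- The given weight is a summand of the total, so it cannot be nonzero when the total is `0`.
  exact h (hS.eq_zero_of_sum h0 (by simpa using h))

end Hom

/-! ### Completeness -/

section Completeness

variable {T Act Out S : Type*} [ConwaySemiring S]

/-- An outcome as a term over the indeterminates `X`. -/
def Outcome.toTExp {X Z : Type*} (idx : Z → X) : Outcome Act Out Z → TExp T Act Out S X
  | .acc => .const (.test .one)
  | .rej => .const (.test .zero)
  | .out v => .const (.ret v)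
  | .step p z => .var (.act p) (idx z)

/-- The system of equations with indeterminates `X` that represent, via `pt`, states of `ρ`. -/
noncomputable def systemOf {X Z : Type*} (ρ : Automaton T Act Out S Z) (pt : X → Z)
    (idx : Z → X) (x : X) : SExp T Act Out S X := fun α =>
  (ρ (pt x) α).support.toList.map fun d => (ρ (pt x) α d, d.toTExp idx)

theorem isSalomaa_systemOf {X Z : Type*} (ρ : Automaton T Act Out S Z) (pt : X → Z)
    (idx : Z → X) : IsSalomaa (systemOf ρ pt idx) := by
  intro x α r g y h α'
  obtain ⟨d, -, hd⟩ := List.mem_map.1 h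
  -- Only steps produce indeterminates; their coefficient `act p` never accepts immediately.
  cases d <;> cases hd
  rfl

variable [Fintype T] [DecidableEq T]

open GuardedExp in
/-- A homomorphism to the automaton of expressions solves the system of its domain. -/
theorem IsHom.provEquiv_hsharp {X Z : Type*} {ρ : Automaton T Act Out S Z}
    {π : Z → Exp T Act Out S} (hπ : IsHom ρ der π) {pt : X → Z} {idx : Z → X} {x : X}
    (hidx : ∀ α p z, ρ (pt x) α (.step p z) ≠ 0 → pt (idx z) = z) :
    ProvEquiv (π (pt x)) (hsharp (fun x => π (pt x)) (systemOf ρ pt idx x)) := by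
  refine .of_forall_atom fun α => mk_eq_mk.1 ?_
  -- The fundamental theorem, pulled back along `π`, and the substituted system become sums over the
  -- same support of `ρ`.
  rw [mk_eq_linearCombination_der, hπ.eq_mapDomain, Finsupp.linearCombination_mapDomain,
    Finsupp.linearCombination_apply, mk_hsharp, systemOf, List.map_map, Finset.sum_map_toList]
  refine Finset.sum_congr rfl fun d hd => congrArg _ ?_
  cases d with
  | step p z =>
    simp [Outcome.map, Outcome.toExp, Outcome.toTExp, TExp.subst,
      hidx α p z (Finsupp.mem_support_iff.1 hd)]
  | _ => rfl

theorem dotEquiv_of_bisimilar (hpos : IsPositive S) {e f : Exp T Act Out S}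
    (h : Bisimilar e f) : DotEquiv e f := by
  classical
  obtain ⟨R, ⟨ρ, h₁, h₂⟩, hef⟩ := h
  obtain ⟨F, hF, heF, hFc⟩ := exists_finite_isClosedUnder_der e
  obtain ⟨G, hG, hfG, hGc⟩ := exists_finite_isClosedUnder_der f
  let X : Set R := {z | z.1.1 ∈ F ∧ z.1.2 ∈ G}
  have hX : X.Finite :=
    (hF.prod hG).preimage (f := fun z : R => z.1) Subtype.val_injective.injOn
  have hXc : IsClosedUnder ρ X := fun z hz α p z' h =>
    ⟨hFc _ hz.1 α p _ (h₁.step_ne_zero hpos h), hGc _ hz.2 α p _ (h₂.step_ne_zero hpos h)⟩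
  have : Finite X := hX
  -- (UA) quantifies over indeterminates in `Type`, while `X` may live in a higher universe.
  obtain ⟨n, ⟨i⟩⟩ := Finite.exists_equiv_fin X
  let z₀ : X := ⟨⟨(e, f), hef⟩, heF, hfG⟩
  let pt : Fin n → R := fun k => (i.symm k).1
  -- Outside `X` the value is arbitrary: closure of `X` ensures that the equations refer only to
  -- states in `X`.
  let idx : R → Fin n := fun z => if hz : z ∈ X then i ⟨z, hz⟩ else i z₀
  have hidx : ∀ k α p z, ρ (pt k) α (.step p z) ≠ 0 → pt (idx z) = z := fun k α p z h => by
    have hz : z ∈ X := hXc _ (i.symm k).2 α p z h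
    simp [pt, idx, hz]
  have key := DotEquiv.UA (systemOf ρ pt idx) (fun k => (pt k).1.1) (fun k => (pt k).1.2)
    (isSalomaa_systemOf ρ pt idx) (fun k => .of_equiv (h₁.provEquiv_hsharp (hidx k)))
    (fun k => .of_equiv (h₂.provEquiv_hsharp (hidx k))) (i z₀)
  simpa [pt, z₀] using key

end Completeness

end WGKAT

theorem mainTheorem1 {T Act Out S : Type*} [Fintype T] [DecidableEq T]
    [WGKAT.ConwaySemiring S] [Nontrivial S]
    (hpos : WGKAT.IsPositive S) (href : WGKAT.IsRefinement S)
    (e f : WGKAT.Exp T Act Out S) (h : WGKAT.Bisimilar e f) :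
    WGKAT.DotEquiv e f := by
  exact WGKAT.dotEquiv_of_bisimilar hpos h
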